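/- Let $M_t,M_r\ge 1$ and let $S_0,\dots,S_{K-1}$ be unitary $M_t\times M_t$ matrices whose columns form mutually unbiased bases of $\mathbb{C}^{M_t}$, i.e. $|\langle s,u\rangle|=1/\sqrt{M_t}$ whenever $s,u$ are columns of two different matrices of the family (every Kerdock family of bases is of this kind). Let $M_t\le N\le K M_t$ and let the beamforming codebook $\mathcal{F}=\{f_1,\dots,f_N\}$ consist of the first $N$ columns of the composite matrix $[S_0\ S_1\ \cdots\ S_{K-1}]$. Consider the limited-feedback beamforming system $y=\sqrt{\mathcal{E}_s}\,H f s+n$, where the $M_r\times M_t$ channel matrix $H$ has i.i.d. $\mathcal{CN}(0,1)$ entries, the noise $n\in\mathbb{C}^{M_r}$ has i.i.d. $\mathcal{CN}(0,N_0)$ entries with $N_0>0$, the symbol $s$ is uniformly distributed on a finite set $\mathcal{A}\subset\mathbb{C}$ with at least two points (for instance a constellation of unit average energy), and $H,s,n$ are independent. The receiver selects $f\in\arg\max_{w\in\mathcal{F}}\|Hw\|_2^2$, forms the maximum ratio combining output $z=(Hf)^*y$ and decides for a symbol $\hat s\in\mathcal{A}$ that minimizes $|z-\sqrt{\mathcal{E}_s}\,\|Hf\|_2^2\,\hat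 s|$ (ties in the selection and in the decision are resolved by arbitrary measurable rules). Let $P_e(\rho)=\Pr(\hat s\ne s)$ be the average symbol error probability at signal-to-noise ratio $\rho=\mathcal{E}_s/N_0$. Then the system has full diversity order $M_tM_r$: $$\lim_{\rho\to\infty}\frac{-\log P_e(\rho)}{\log\rho}=M_tM_r .$$ -/

import Mathlib

open MeasureTheory ProbabilityTheory Filter Topology
open scoped NNReal Matrix

noncomputable section

namespace LimitedFeedback

/-! ### Mutually unbiased bases and the beamforming codebook -/

/-- A finite family `S 0, …, S (K - 1)` of mutually unbiased bases of `ℂ ^ Mt`: every `S k` is a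
unitary `Mt × Mt` matrix (its columns are an orthonormal basis), and columns of two different
members of the family have an inner product of modulus `1 / √Mt`. -/
structure IsMUB {Mt K : ℕ} (S : Fin K → Matrix (Fin Mt) (Fin Mt) ℂ) : Prop where
  unitary : ∀ k, (S k)ᴴ * S k = 1
  unbiased : ∀ k l, k ≠ l → ∀ n m : Fin Mt,
    ‖star ((S k).col n) ⬝ᵥ (S l).col m‖ = 1 / Real.sqrt Mt

/-- The composite matrix `[S 0  S 1  ⋯  S (K - 1)]`: column number `Mt * k + j` is column `j`
of `S k`. -/
def composite {Mt K : ℕ} (S : Fin K → Matrix (Fin Mt) (Fin Mt) ℂ) :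
    Matrix (Fin Mt) (Fin (K * Mt)) ℂ :=
  Matrix.of fun i c => S (finProdFinEquiv.symm c).1 i (finProdFinEquiv.symm c).2

/-- The beamforming codebook with `N` codewords: the first `N` columns of the composite matrix. -/
def codebook {Mt K : ℕ} (S : Fin K → Matrix (Fin Mt) (Fin Mt) ℂ) {N : ℕ} (hN : N ≤ K * Mt) :
    Fin N → (Fin Mt → ℂ) :=
  fun i => (composite S).col (Fin.castLE hN i)

/-! ### The random channel and the noise -/

/-- The circularly symmetric complex Gaussian law `CN(0, v)`: real and imaginary part are
independent real Gaussians with mean `0` and variance `v / 2`. -/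
def complexGaussian (v : ℝ≥0) : Measure ℂ :=
  ((gaussianReal 0 (v / 2)).prod (gaussianReal 0 (v / 2))).map
    (fun p : ℝ × ℝ => (⟨p.1, p.2⟩ : ℂ))

/-- The channel matrices, written as functions of two indices, so that the product σ-algebra is
available. -/
abbrev Channel (Mr Mt : ℕ) : Type := Fin Mr → Fin Mt → ℂ

/-- The law of the Rayleigh fading `Mr × Mt` channel matrix: i.i.d. `CN(0, 1)` entries. -/
def channelLaw (Mr Mt : ℕ) : Measure (Channel Mr Mt) :=
  Measure.pi fun _ => Measure.pi fun _ => complexGaussian 1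

/-- The law of the noise vector: i.i.d. `CN(0, N₀)` entries. -/
def noiseLaw (Mr : ℕ) (N₀ : ℝ≥0) : Measure (Fin Mr → ℂ) :=
  Measure.pi fun _ => complexGaussian N₀

/-! ### Transmission, codeword selection and detection -/

/-- The squared Euclidean norm of a complex vector. -/
def normSq {n : ℕ} (v : Fin n → ℂ) : ℝ := ∑ i, ‖v i‖ ^ 2

/-- The effective channel `H f` of the channel `H` and the beamforming vector `f`. -/
def effective {Mr Mt : ℕ} (H : Channel Mr Mt) (f : Fin Mt → ℂ) : Fin Mr → ℂ := Matrix.of H *ᵥ f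

/-- The received vector `y = √Es · g · s + n`, where `g = H f` is the effective channel. -/
def received {Mr : ℕ} (Es : ℝ) (g : Fin Mr → ℂ) (s : ℂ) (n : Fin Mr → ℂ) : Fin Mr → ℂ :=
  ((Real.sqrt Es : ℂ) * s) • g + n

/-- The output `g* y` of the maximum ratio combiner for the effective channel `g`. -/
def mrc {Mr : ℕ} (g y : Fin Mr → ℂ) : ℂ := star g ⬝ᵥ y

/-- `sel` is an optimal codeword selection rule for the codebook `F`: it is a (measurable) function
of the channel matrix `H`, and the selected codeword maximizes `‖H w‖²` over the codewords `w`. -/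
structure IsOptimalSelection {Mr Mt N : ℕ} (F : Fin N → (Fin Mt → ℂ))
    (sel : Channel Mr Mt → Fin N) : Prop where
  measurable : Measurable sel
  optimal : ∀ H i, normSq (effective H (F i)) ≤ normSq (effective H (F (sel H)))

/-- `det` is a minimum distance detector for the constellation `A` after maximum ratio combining,
at transmit power `Es`: it is a (measurable) function of the effective channel `g` and the received
vector `y`, and decides for a point of `A` whose noise-free combiner output
`g* (√Es · g · s)` is closest to the actual output `g* y`. Ties are resolved arbitrarily. -/
structure IsMinDistDetector {Mr : ℕ} (A : Finset ℂ) (Es : ℝ)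
    (det : (Fin Mr → ℂ) → (Fin Mr → ℂ) → ℂ) : Prop where
  measurable : Measurable fun p : (Fin Mr → ℂ) × (Fin Mr → ℂ) => det p.1 p.2
  mem : ∀ g y, det g y ∈ A
  closest : ∀ g y, ∀ t ∈ A,
    ‖mrc g y - mrc g (received Es g (det g y) 0)‖ ≤ ‖mrc g y - mrc g (received Es g t 0)‖

/-- The average probability of a symbol error of the limited feedback beamforming system: the
symbol `s` is uniform on the constellation `A`, the channel `H` and the noise `n` have the laws
above, and `s`, `H`, `n` are independent. -/
def symbolErrorProb {Mr Mt N : ℕ} (F : Fin N → (Fin Mt → ℂ)) (A : Finset ℂ)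
    (sel : Channel Mr Mt → Fin N) (det : (Fin Mr → ℂ) → (Fin Mr → ℂ) → ℂ)
    (Es : ℝ) (N₀ : ℝ≥0) : ℝ :=
  (A.card : ℝ)⁻¹ * ∑ s ∈ A, ((channelLaw Mr Mt).prod (noiseLaw Mr N₀)).real
    {p | det (effective p.1 (F (sel p.1)))
      (received Es (effective p.1 (F (sel p.1))) s p.2) ≠ s}

/-- A system whose error probability at signal-to-noise ratio `ρ` is `Pe ρ` has diversity order
`d` if `- log (Pe ρ) / log ρ` tends to `d` as `ρ → ∞`. -/
def HasDiversityOrder (Pe : ℝ → ℝ) (d : ℝ) : Prop :=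
  Tendsto (fun ρ => - Real.log (Pe ρ) / Real.log ρ) atTop (𝓝 d)

end LimitedFeedback

end

namespace LimitedFeedback

/-! ### Gaussian estimates -/

/-! The first `Mt` codewords form an orthonormal basis, so the squared norms of `H f` over them sum
to the squared Frobenius norm of `H`. All codewords are unit vectors. Hence the selected gain lies
between `‖H‖² / Mt` and `‖H‖²` (`sum_normSq_le`, `normSq_effective_le`), and `‖H‖² ≤ r` has
probability of order `r ^ (Mt * Mr)` for small `r`.

Upper bound: an error forces `Es * ‖H f‖² ≤ const * ‖n‖²` (`normSq_le_of_ne`). For fixed noise this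
is a small-ball event for `H`; integrating over `n` costs only a finite Gaussian moment.

Lower bound: with probability of order `Es ^ (-(Mt * Mr))` the entries of `H` lie in a box of side
of order `Es ^ (-1/2)`. There the signal is weak enough that noise pointing from `s` towards `t`
causes an error, with conditional probability bounded below (`ne_of_halfPlane`,
`le_noiseLaw_halfPlanes`). -/

theorem measurable_complexMk : Measurable fun p : ℝ × ℝ => (⟨p.1, p.2⟩ : ℂ) :=
  Complex.measurableEquivRealProd.symm.measurable

instance isProbabilityMeasure_complexGaussian (v : ℝ≥0) :
    IsProbabilityMeasure (complexGaussian v) :=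
  Measure.isProbabilityMeasure_map measurable_complexMk.aemeasurable

instance isProbabilityMeasure_noiseLaw (Mr : ℕ) (N₀ : ℝ≥0) :
    IsProbabilityMeasure (noiseLaw Mr N₀) := by
  unfold noiseLaw; infer_instance

instance isProbabilityMeasure_channelLaw (Mr Mt : ℕ) :
    IsProbabilityMeasure (channelLaw Mr Mt) := by
  unfold channelLaw; infer_instance

theorem complexGaussian_reProdIm (v : ℝ≥0) {I J : Set ℝ} (hI : MeasurableSet I)
    (hJ : MeasurableSet J) :
    complexGaussian v (I ×ℂ J) = gaussianReal 0 (v / 2) I * gaussianReal 0 (v / 2) J := by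
  rw [complexGaussian, Measure.map_apply measurable_complexMk, ← Measure.prod_prod]
  · rfl
  · exact (Complex.measurable_re hI).inter (Complex.measurable_im hJ)

theorem gaussianReal_Icc_le {v : ℝ≥0} (hv : v ≠ 0) :
    ∃ C : ℝ, 0 < C ∧ ∀ r : ℝ, 0 ≤ r →
      gaussianReal 0 v (Set.Icc (-r) r) ≤ ENNReal.ofReal (C * r) := by
  have hv' : (0 : ℝ) < v := by positivity
  refine ⟨(√(2 * Real.pi * v))⁻¹ * 2, by positivity, fun r hr => ?_⟩
  rw [gaussianReal_apply _ hv]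
  calc ∫⁻ x in Set.Icc (-r) r, gaussianPDF 0 v x
      ≤ ∫⁻ _ in Set.Icc (-r) r, ENNReal.ofReal (√(2 * Real.pi * v))⁻¹ := by
        refine lintegral_mono fun x => ENNReal.ofReal_le_ofReal ?_
        refine mul_le_of_le_one_right (by positivity) (Real.exp_le_one_iff.2 ?_)
        rw [neg_div]
        exact neg_nonpos.2 (by positivity)
    _ = _ := by
        rw [setLIntegral_const, Real.volume_Icc, ← ENNReal.ofReal_mul (by positivity)]
        congr 1; ring

theorem le_gaussianReal_Ioc {v : ℝ≥0} (hv : v ≠ 0) :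
    ∃ c : ℝ, 0 < c ∧ ∀ r : ℝ, 0 ≤ r → r ≤ 1 →
      ENNReal.ofReal (c * r) ≤ gaussianReal 0 v (Set.Ioc 0 r) := by
  have hv' : (0 : ℝ) < v := by positivity
  refine ⟨gaussianPDFReal 0 v 1, gaussianPDFReal_pos _ _ _ hv, fun r hr hr1 => ?_⟩
  rw [gaussianReal_apply _ hv]
  calc ENNReal.ofReal (gaussianPDFReal 0 v 1 * r)
      = ∫⁻ _ in Set.Ioc 0 r, gaussianPDF 0 v 1 := by
        rw [setLIntegral_const, Real.volume_Ioc, gaussianPDF,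
          ← ENNReal.ofReal_mul (gaussianPDFReal_nonneg _ _ _), sub_zero]
    _ ≤ _ := by
        refine setLIntegral_mono (measurable_gaussianPDF 0 v) fun x hx =>
          ENNReal.ofReal_le_ofReal ?_
        refine mul_le_mul_of_nonneg_left (Real.exp_le_exp.2 ?_) (by positivity)
        have : x ^ 2 ≤ 1 := by nlinarith [hx.1, hx.2]
        simp only [sub_zero, neg_div, one_pow]
        gcongr

theorem gaussianReal_pos_of_volume_ne_zero {v : ℝ≥0} (hv : v ≠ 0) {s : Set ℝ}
    (hs : volume s ≠ 0) : 0 < gaussianReal 0 v s :=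
  pos_iff_ne_zero.2 fun h => hs (gaussianReal_absolutelyContinuous' 0 hv h)

theorem complexGaussian_closedBall_le {v : ℝ≥0} (hv : v ≠ 0) :
    ∃ C : ℝ, 0 < C ∧ ∀ r : ℝ, 0 ≤ r →
      complexGaussian v {z | ‖z‖ ^ 2 ≤ r} ≤ ENNReal.ofReal (C * r) := by
  obtain ⟨C, hC, h⟩ := gaussianReal_Icc_le (v := v / 2) (by positivity)
  refine ⟨C ^ 2, by positivity, fun r hr => ?_⟩
  calc complexGaussian v {z | ‖z‖ ^ 2 ≤ r}
      ≤ complexGaussian v (Set.Icc (-√r) (√r) ×ℂ Set.Icc (-√r) (√r)) := by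
        refine measure_mono fun z hz => ?_
        have hz' : ‖z‖ ≤ √r := Real.le_sqrt_of_sq_le hz
        exact ⟨abs_le.1 ((Complex.abs_re_le_norm z).trans hz'),
          abs_le.1 ((Complex.abs_im_le_norm z).trans hz')⟩
    _ ≤ ENNReal.ofReal (C * √r) * ENNReal.ofReal (C * √r) := by
        rw [complexGaussian_reProdIm _ measurableSet_Icc measurableSet_Icc]
        exact mul_le_mul' (h _ (Real.sqrt_nonneg _)) (h _ (Real.sqrt_nonneg _))
    _ = ENNReal.ofReal (C ^ 2 * r) := by
        rw [← ENNReal.ofReal_mul (by positivity)]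
        congr 1
        rw [mul_mul_mul_comm, Real.mul_self_sqrt hr]; ring

/-- The intervals exclude `0`, so that a channel with all its entries in the box is nonzero. -/
theorem le_complexGaussian_box {v : ℝ≥0} (hv : v ≠ 0) :
    ∃ c : ℝ, 0 < c ∧ ∀ r : ℝ, 0 ≤ r → r ≤ 1 →
      ENNReal.ofReal (c * r ^ 2) ≤ complexGaussian v (Set.Ioc 0 r ×ℂ Set.Ioc 0 r) := by
  obtain ⟨c, hc, h⟩ := le_gaussianReal_Ioc (v := v / 2) (by positivity)
  refine ⟨c ^ 2, by positivity, fun r hr hr1 => ?_⟩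
  rw [complexGaussian_reProdIm _ measurableSet_Ioc measurableSet_Ioc]
  calc ENNReal.ofReal (c ^ 2 * r ^ 2) = ENNReal.ofReal (c * r) * ENNReal.ofReal (c * r) := by
        rw [← ENNReal.ofReal_mul (by positivity)]
        congr 1; ring
    _ ≤ _ := mul_le_mul' (h r hr hr1) (h r hr hr1)

/-- Half-planes at a fixed distance of the origin have a complex Gaussian probability that is
bounded below, whatever their direction. -/
theorem le_complexGaussian_halfPlane {v : ℝ≥0} (hv : v ≠ 0) (τ : ℝ) :
    ∃ c : ENNReal, 0 < c ∧ ∀ u : ℂ,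
      c ≤ complexGaussian v {z | ‖u‖ * τ ≤ (u * z).re} := by
  have hv2 : v / 2 ≠ 0 := by positivity
  -- The positive part is needed because `‖u‖ ≤ |u.re| + |u.im|` gets multiplied by the threshold.
  set τ' : ℝ := max τ 0
  have hτ0 : 0 ≤ τ' := le_max_right _ _
  set a := gaussianReal 0 (v / 2) (Set.Ici τ')
  set b := gaussianReal 0 (v / 2) (Set.Iic (-τ'))
  have ha : 0 < a := gaussianReal_pos_of_volume_ne_zero hv2 (by simp)
  have hb : 0 < b := gaussianReal_pos_of_volume_ne_zero hv2 (by simp)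
  -- Each coordinate of `z` is pushed to the side given by the sign of its coefficient in `(u *
  -- z).re = u.re * z.re - u.im * z.im`; only two half-lines occur, hence uniformity in `u`.
  have key : ∀ x : ℝ, ∃ I : Set ℝ, MeasurableSet I ∧ min a b ≤ gaussianReal 0 (v / 2) I ∧
      ∀ y ∈ I, |x| * τ' ≤ x * y := by
    intro x
    rcases le_total 0 x with hx | hx
    · refine ⟨Set.Ici τ', measurableSet_Ici, min_le_left _ _, fun y hy => ?_⟩
      rw [abs_of_nonneg hx]
      exact mul_le_mul_of_nonneg_left hy hx
    · refine ⟨Set.Iic (-τ'), measurableSet_Iic, min_le_right _ _, fun y hy => ?_⟩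
      rw [abs_of_nonpos hx]
      nlinarith [Set.mem_Iic.1 hy]
  refine ⟨min a b * min a b, ENNReal.mul_pos (lt_min ha hb).ne' (lt_min ha hb).ne',
    fun u => ?_⟩
  obtain ⟨I, hI, hIm, hIy⟩ := key u.re
  obtain ⟨J, hJ, hJm, hJy⟩ := key (-u.im)
  calc min a b * min a b ≤ _ := mul_le_mul' hIm hJm
    _ = complexGaussian v (I ×ℂ J) := (complexGaussian_reProdIm v hI hJ).symm
    _ ≤ _ := by
      refine measure_mono fun z hz => ?_
      have h1 := hIy _ hz.1
      have h2 := hJy _ hz.2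
      rw [abs_neg] at h2
      have h3 : ‖u‖ * τ ≤ (|u.re| + |u.im|) * τ' :=
        (mul_le_mul_of_nonneg_left (le_max_left _ _) (norm_nonneg _)).trans
          (mul_le_mul_of_nonneg_right (Complex.norm_le_abs_re_add_abs_im u) hτ0)
      simp only [Set.mem_ofPred_eq, Complex.mul_re]
      linarith

theorem memLp_id_complexGaussian (v : ℝ≥0) {p : ENNReal} (hp : p ≠ ⊤) :
    MemLp id p (complexGaussian v) := by
  rw [complexGaussian, memLp_map_measure_iff (by fun_prop) measurable_complexMk.aemeasurable]
  have h := memLp_id_gaussianReal' (μ := 0) (v := v / 2) p hp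
  have h1 : MemLp (fun q : ℝ × ℝ => (q.1 : ℂ)) p
      ((gaussianReal 0 (v / 2)).prod (gaussianReal 0 (v / 2))) := (h.comp_fst _).ofReal
  have h2 : MemLp (fun q : ℝ × ℝ => (q.2 : ℂ)) p
      ((gaussianReal 0 (v / 2)).prod (gaussianReal 0 (v / 2))) := (h.comp_snd _).ofReal
  refine (h1.add (h2.mul_const Complex.I)).ae_eq (.of_forall fun q => ?_)
  exact (Complex.mk_eq_add_mul_I q.1 q.2).symm

theorem channelLaw_pi (Mr Mt : ℕ) (B : Set ℂ) :
    channelLaw Mr Mt {H | ∀ i j, H i j ∈ B} = complexGaussian 1 B ^ (Mt * Mr) := by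
  have h : {H : Channel Mr Mt | ∀ i j, H i j ∈ B} =
      Set.pi Set.univ fun _ => Set.pi Set.univ fun _ => B := by
    ext H; simp [Set.mem_pi]
  rw [h, channelLaw, Measure.pi_pi]
  simp only [Measure.pi_pi, Finset.prod_const, Finset.card_univ, Fintype.card_fin, pow_mul]

theorem normSq_nonneg {n : ℕ} (v : Fin n → ℂ) : 0 ≤ normSq v :=
  Finset.sum_nonneg fun _ _ => by positivity

theorem lintegral_normSq_pow_lt_top (Mr : ℕ) (N₀ : ℝ≥0) (D : ℕ) :
    ∫⁻ n, ENNReal.ofReal (normSq n) ^ D ∂noiseLaw Mr N₀ < ⊤ := by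
  have h1 : MemLp (fun n : Fin Mr → ℂ => ∑ i, ‖n i‖) ((2 * D : ℕ) : ENNReal)
      (noiseLaw Mr N₀) :=
    memLp_finsetSum _ fun i _ =>
      ((memLp_id_complexGaussian N₀ (ENNReal.natCast_ne_top _)).comp_measurePreserving
        (measurePreserving_eval (fun _ : Fin Mr => complexGaussian N₀) i)).norm
  refine lt_of_le_of_lt (lintegral_mono fun n => ?_) h1.integrable_norm_pow'.lintegral_lt_top
  rw [← ENNReal.ofReal_pow (normSq_nonneg n)]
  refine ENNReal.ofReal_le_ofReal ?_
  rw [pow_mul, Real.norm_eq_abs, sq_abs]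
  exact pow_le_pow_left₀ (normSq_nonneg n)
    (Finset.sum_sq_le_sq_sum_of_nonneg fun _ _ => norm_nonneg _) D

/-! ### The codebook and the effective channel -/

theorem IsMUB.normSq_codebook {Mt K N : ℕ} {S : Fin K → Matrix (Fin Mt) (Fin Mt) ℂ}
    (hS : IsMUB S) (hN : N ≤ K * Mt) (i : Fin N) : normSq (codebook S hN i) = 1 := by
  set c := finProdFinEquiv.symm (Fin.castLE hN i)
  have h := congrFun (congrFun (hS.unitary c.1) c.2) c.2
  rw [Matrix.one_apply_eq, Matrix.mul_apply] at h
  have h' : ((normSq (codebook S hN i) : ℝ) : ℂ) = 1 := by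
    rw [← h, normSq, Complex.ofReal_sum]
    refine Finset.sum_congr rfl fun j _ => ?_
    rw [Complex.ofReal_pow, ← Complex.conj_mul', Matrix.conjTranspose_apply]
    rfl
  exact_mod_cast h'

theorem codebook_castLE {Mt K N : ℕ} (S : Fin K → Matrix (Fin Mt) (Fin Mt) ℂ) (hN : Mt ≤ N)
    (hNK : N ≤ K * Mt) (hK : 0 < K) (j : Fin Mt) :
    codebook S hNK (Fin.castLE hN j) = (S ⟨0, hK⟩).col j := by
  have h : finProdFinEquiv.symm (Fin.castLE hNK (Fin.castLE hN j)) = (⟨0, hK⟩, j) := by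
    rw [Equiv.symm_apply_eq]
    ext
    simp [finProdFinEquiv]
  ext i
  simp only [codebook, composite, Matrix.col_apply, Matrix.of_apply, h]

theorem norm_dotProduct_sq_le {n : ℕ} (v w : Fin n → ℂ) :
    ‖v ⬝ᵥ w‖ ^ 2 ≤ normSq v * normSq w := by
  have h : ‖v ⬝ᵥ w‖ ≤ ∑ i, ‖v i‖ * ‖w i‖ :=
    (norm_sum_le _ _).trans_eq (Finset.sum_congr rfl fun i _ => norm_mul _ _)
  exact (pow_le_pow_left₀ (norm_nonneg _) h 2).trans (Finset.sum_mul_sq_le_sq_mul_sq _ _ _)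

theorem normSq_star {n : ℕ} (v : Fin n → ℂ) : normSq (star v) = normSq v := by
  simp [normSq]

theorem normSq_vecMul_of_unitary {n : ℕ} {U : Matrix (Fin n) (Fin n) ℂ} (hU : Uᴴ * U = 1)
    (v : Fin n → ℂ) : normSq (v ᵥ* U) = normSq v := by
  have key : ∀ w : Fin n → ℂ, ((normSq w : ℝ) : ℂ) = w ⬝ᵥ star w := fun w => by
    rw [normSq, Complex.ofReal_sum]
    refine Finset.sum_congr rfl fun j _ => ?_
    rw [Complex.ofReal_pow, ← Complex.mul_conj']
    rfl
  have h : ((normSq (v ᵥ* U) : ℝ) : ℂ) = (normSq v : ℝ) := by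
    rw [key, key, Matrix.star_vecMul, ← Matrix.dotProduct_mulVec, Matrix.mulVec_mulVec,
      mul_eq_one_comm.1 hU, Matrix.one_mulVec]
  exact_mod_cast h

theorem normSq_effective_le {Mr Mt : ℕ} (H : Channel Mr Mt) (f : Fin Mt → ℂ) :
    normSq (effective H f) ≤ (∑ i, normSq (H i)) * normSq f := by
  rw [Finset.sum_mul]
  exact Finset.sum_le_sum fun i _ => norm_dotProduct_sq_le (H i) f

/-- After exchanging the sums, this is the isometry `v ↦ v ᵥ* U` applied to each row of `H`. -/
theorem sum_normSq_effective_col {Mr Mt : ℕ} (H : Channel Mr Mt)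
    {U : Matrix (Fin Mt) (Fin Mt) ℂ} (hU : Uᴴ * U = 1) :
    ∑ j, normSq (effective H (U.col j)) = ∑ i, normSq (H i) := by
  simp only [normSq]
  rw [Finset.sum_comm]
  exact Finset.sum_congr rfl fun i _ => normSq_vecMul_of_unitary hU (H i)

/-- The maximum over the codebook is at least the average over the basis `S 0` that it contains. -/
theorem IsOptimalSelection.sum_normSq_le {Mr Mt K N : ℕ}
    {S : Fin K → Matrix (Fin Mt) (Fin Mt) ℂ} (hS : IsMUB S) (hN : Mt ≤ N) (hNK : N ≤ K * Mt)
    (hMt : 0 < Mt) {sel : Channel Mr Mt → Fin N}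
    (hsel : IsOptimalSelection (codebook S hNK) sel) (H : Channel Mr Mt) :
    ∑ i, normSq (H i) ≤ Mt * normSq (effective H (codebook S hNK (sel H))) := by
  have hK : 0 < K := Nat.pos_of_ne_zero fun h => by subst h; omega
  rw [← sum_normSq_effective_col H (hS.unitary ⟨0, hK⟩)]
  refine (Finset.sum_le_card_nsmul _ _ (normSq (effective H (codebook S hNK (sel H))))
    fun j _ => ?_).trans_eq (by simp)
  rw [← codebook_castLE S hN hNK hK]
  exact hsel.optimal H _

theorem IsOptimalSelection.measurable_effective {Mr Mt N : ℕ} {F : Fin N → (Fin Mt → ℂ)}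
    {sel : Channel Mr Mt → Fin N} (hsel : IsOptimalSelection F sel) :
    Measurable fun H => effective H (F (sel H)) := by
  have h : Measurable fun p : Channel Mr Mt × Fin N => effective p.1 (F p.2) := by
    refine measurable_from_prod_countable_left fun k => ?_
    unfold effective Matrix.mulVec dotProduct
    refine measurable_pi_lambda _ fun i => ?_
    simp only [Matrix.of_apply]
    fun_prop
  exact h.comp (measurable_id.prodMk hsel.measurable)

/-! ### Decision errors -/

theorem mrc_received {Mr : ℕ} (Es : ℝ) (g : Fin Mr → ℂ) (s : ℂ) (n : Fin Mr → ℂ) :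
    mrc g (received Es g s n) = ((√Es * normSq g : ℝ) : ℂ) * s + mrc g n := by
  have h : star g ⬝ᵥ g = ((normSq g : ℝ) : ℂ) := by
    rw [normSq, Complex.ofReal_sum]
    refine Finset.sum_congr rfl fun j _ => ?_
    rw [Complex.ofReal_pow, ← Complex.conj_mul']
    rfl
  rw [mrc, mrc, received, dotProduct_add, dotProduct_smul, h, smul_eq_mul]
  push_cast
  ring

theorem norm_mrc_received_sub {Mr : ℕ} (Es : ℝ) (g : Fin Mr → ℂ) (s t : ℂ) (n : Fin Mr → ℂ) :
    ‖mrc g (received Es g s n) - mrc g (received Es g t 0)‖ =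
      ‖mrc g n - ((√Es * normSq g : ℝ) : ℂ) * (t - s)‖ := by
  rw [mrc_received, mrc_received]
  congr 1
  simp [mrc]
  ring

/-- The triangle inequality gives `√Es * ‖g‖² * ‖t - s‖ ≤ 2 * |g* n|`; Cauchy–Schwarz bounds `|g*
n|` by `‖g‖ * ‖n‖`, and one factor `‖g‖²` cancels after squaring. -/
theorem IsMinDistDetector.normSq_le_of_ne {Mr : ℕ} {A : Finset ℂ} {Es : ℝ} (hEs : 0 < Es)
    {det : (Fin Mr → ℂ) → (Fin Mr → ℂ) → ℂ} (hdet : IsMinDistDetector A Es det)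
    {δ : ℝ} (hδ : 0 ≤ δ) (hA : ∀ s ∈ A, ∀ t ∈ A, t ≠ s → δ ≤ ‖t - s‖)
    {g n : Fin Mr → ℂ} {s : ℂ} (hs : s ∈ A) (h : det g (received Es g s n) ≠ s) :
    Es * normSq g * δ ^ 2 ≤ 4 * normSq n := by
  have h1 := hdet.closest g (received Es g s n) s hs
  have h2 := hA s hs _ (hdet.mem g (received Es g s n)) h
  set t := det g (received Es g s n)
  rw [norm_mrc_received_sub, norm_mrc_received_sub, sub_self, mul_zero, sub_zero] at h1
  have hg := normSq_nonneg g
  have h3 : √Es * normSq g * ‖t - s‖ ≤ 2 * ‖mrc g n‖ := by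
    have h4 : ‖((√Es * normSq g : ℝ) : ℂ) * (t - s)‖ = √Es * normSq g * ‖t - s‖ := by
      rw [norm_mul, Complex.norm_real, Real.norm_of_nonneg (by positivity)]
    have h5 := norm_sub_norm_le (((√Es * normSq g : ℝ) : ℂ) * (t - s)) (mrc g n)
    rw [norm_sub_rev] at h5
    linarith
  have h6 : √Es * normSq g * δ ≤ 2 * ‖mrc g n‖ :=
    (mul_le_mul_of_nonneg_left h2 (by positivity)).trans h3
  have h7 : ‖mrc g n‖ ^ 2 ≤ normSq g * normSq n := by
    simpa only [mrc, normSq_star] using norm_dotProduct_sq_le (star g) n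
  have h8 := pow_le_pow_left₀ (by positivity) h6 2
  rw [mul_pow, mul_pow, mul_pow, Real.sq_sqrt hEs.le] at h8
  rcases hg.eq_or_lt with h0 | h0
  · rw [← h0]; nlinarith [normSq_nonneg n]
  · refine le_of_mul_le_mul_left ?_ h0
    nlinarith

/-- With `a = √Es * ‖g‖²`, `d = t - s`, `w = g* n`, the hypothesis is `|w - a d|² < |w|²` expanded
and divided by `a`. Being strict, it excludes `s` under any tie-breaking rule. -/
theorem IsMinDistDetector.ne_of_lt {Mr : ℕ} {A : Finset ℂ} {Es : ℝ}
    {det : (Fin Mr → ℂ) → (Fin Mr → ℂ) → ℂ} (hdet : IsMinDistDetector A Es det)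
    {g n : Fin Mr → ℂ} {s t : ℂ} (ht : t ∈ A) (hEs : 0 < Es) (hg : 0 < normSq g)
    (h : √Es * normSq g * ‖t - s‖ ^ 2 < 2 * (star (t - s) * mrc g n).re) :
    det g (received Es g s n) ≠ s := by
  intro hs
  have h1 := hdet.closest g (received Es g s n) t ht
  rw [hs, norm_mrc_received_sub, norm_mrc_received_sub, sub_self, mul_zero, sub_zero] at h1
  have h2 := pow_le_pow_left₀ (norm_nonneg _) h1 2
  have ha : 0 < √Es * normSq g := mul_pos (Real.sqrt_pos.2 hEs) hg
  set a := √Es * normSq g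
  set d := t - s
  set w := mrc g n
  rw [← Complex.normSq_eq_norm_sq, ← Complex.normSq_eq_norm_sq, Complex.normSq_apply,
    Complex.normSq_apply] at h2
  rw [← Complex.normSq_eq_norm_sq, Complex.normSq_apply] at h
  simp only [Complex.sub_re, Complex.sub_im, Complex.im_ofReal_mul, Complex.mul_re,
    Complex.ofReal_re, Complex.ofReal_im, zero_mul, Complex.star_def, Complex.conj_re, Complex.conj_im] at h h2
  nlinarith

/-- If the components of the noise all point towards `t - s`, and the effective channel is weak,
then `s` is not detected. -/
theorem IsMinDistDetector.ne_of_halfPlane {Mr : ℕ} {A : Finset ℂ} {Es : ℝ}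
    {det : (Fin Mr → ℂ) → (Fin Mr → ℂ) → ℂ} (hdet : IsMinDistDetector A Es det)
    {g n : Fin Mr → ℂ} {s t : ℂ} (ht : t ∈ A) (hst : t ≠ s) (hEs : 0 < Es)
    (hg : 0 < normSq g) {τ : ℝ} (hτ : 0 < τ) (hgτ : Es * normSq g ≤ τ ^ 2)
    (h : ∀ i, ‖star (t - s) * star (g i)‖ * (τ * ‖t - s‖) ≤
      (star (t - s) * star (g i) * n i).re) :
    det g (received Es g s n) ≠ s := by
  refine hdet.ne_of_lt ht hEs hg ?_
  have hd : 0 < ‖t - s‖ := norm_pos_iff.2 (sub_ne_zero.2 hst)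
  have h1 : ‖t - s‖ ^ 2 * τ * ∑ i, ‖g i‖ ≤ (star (t - s) * mrc g n).re := by
    rw [mrc, dotProduct, Finset.mul_sum, Finset.mul_sum, Complex.re_sum]
    refine Finset.sum_le_sum fun i _ => ?_
    have := h i
    rw [norm_mul, norm_star, norm_star] at this
    rw [Pi.star_apply, ← mul_assoc]
    linarith
  have h2 : √(normSq g) ≤ ∑ i, ‖g i‖ :=
    Real.sqrt_le_iff.2 ⟨by positivity, Finset.sum_sq_le_sq_sum_of_nonneg fun _ _ => norm_nonneg _⟩
  have h3 : √Es * √(normSq g) ≤ τ := by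
    rw [← Real.sqrt_mul hEs.le]
    exact Real.sqrt_le_iff.2 ⟨hτ.le, hgτ⟩
  have hg' : 0 < √(normSq g) := Real.sqrt_pos.2 hg
  calc √Es * normSq g * ‖t - s‖ ^ 2
      = ‖t - s‖ ^ 2 * (√Es * √(normSq g)) * √(normSq g) := by
        nth_rewrite 1 [← Real.mul_self_sqrt hg.le]; ring
    _ ≤ ‖t - s‖ ^ 2 * τ * √(normSq g) := by gcongr
    _ < 2 * (‖t - s‖ ^ 2 * τ * √(normSq g)) := by
        have : 0 < ‖t - s‖ ^ 2 * τ * √(normSq g) := by positivity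
        linarith
    _ ≤ 2 * (‖t - s‖ ^ 2 * τ * ∑ i, ‖g i‖) := by gcongr
    _ ≤ _ := by linarith

theorem exists_pos_le_norm_sub (A : Finset ℂ) :
    ∃ δ : ℝ, 0 < δ ∧ ∀ s ∈ A, ∀ t ∈ A, t ≠ s → δ ≤ ‖t - s‖ := by
  rcases A.offDiag.eq_empty_or_nonempty with h | h
  · refine ⟨1, one_pos, fun s hs t ht hts => absurd h ?_⟩
    exact Finset.ne_empty_of_mem (a := (t, s)) (Finset.mem_offDiag.2 ⟨ht, hs, hts⟩)
  · obtain ⟨p, hp, hmin⟩ := Finset.exists_min_image _ (fun p : ℂ × ℂ => ‖p.1 - p.2‖) h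
    obtain ⟨-, -, hne⟩ := Finset.mem_offDiag.1 hp
    exact ⟨‖p.1 - p.2‖, norm_pos_iff.2 (sub_ne_zero.2 hne), fun s hs t ht hts =>
      hmin (t, s) (Finset.mem_offDiag.2 ⟨ht, hs, hts⟩)⟩

/-- The event that the symbol `s` is not detected. -/
def errorSet {Mr Mt N : ℕ} (F : Fin N → (Fin Mt → ℂ)) (sel : Channel Mr Mt → Fin N)
    (det : (Fin Mr → ℂ) → (Fin Mr → ℂ) → ℂ) (Es : ℝ) (s : ℂ) :
    Set (Channel Mr Mt × (Fin Mr → ℂ)) :=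
  {p | det (effective p.1 (F (sel p.1))) (received Es (effective p.1 (F (sel p.1))) s p.2) ≠ s}

theorem measurableSet_errorSet {Mr Mt N : ℕ} {F : Fin N → (Fin Mt → ℂ)}
    {sel : Channel Mr Mt → Fin N} (hsel : IsOptimalSelection F sel) {A : Finset ℂ} {Es : ℝ}
    {det : (Fin Mr → ℂ) → (Fin Mr → ℂ) → ℂ} (hdet : IsMinDistDetector A Es det) (s : ℂ) :
    MeasurableSet (errorSet F sel det Es s) := by
  have h1 : Measurable fun p : Channel Mr Mt × (Fin Mr → ℂ) => effective p.1 (F (sel p.1)) :=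
    hsel.measurable_effective.comp measurable_fst
  have h2 : Measurable fun p : Channel Mr Mt × (Fin Mr → ℂ) =>
      received Es (effective p.1 (F (sel p.1))) s p.2 :=
    (h1.const_smul ((√Es : ℂ) * s)).add measurable_snd
  exact (hdet.measurable.comp (h1.prodMk h2)) (measurableSet_singleton s).compl

/-- The channel is small with a probability that decays like the power `Mt * Mr` of the size. -/
theorem channelLaw_sum_normSq_le (Mr Mt : ℕ) :
    ∃ C : ℝ, 0 < C ∧ ∀ r : ℝ, 0 ≤ r →
      channelLaw Mr Mt {H | ∑ i, normSq (H i) ≤ r} ≤ ENNReal.ofReal (C * r) ^ (Mt * Mr) := by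
  obtain ⟨C, hC, h⟩ := complexGaussian_closedBall_le (v := 1) one_ne_zero
  refine ⟨C, hC, fun r hr => ?_⟩
  calc channelLaw Mr Mt {H | ∑ i, normSq (H i) ≤ r}
      ≤ channelLaw Mr Mt {H | ∀ i j, H i j ∈ {z : ℂ | ‖z‖ ^ 2 ≤ r}} := by
        refine measure_mono fun H (hH : ∑ i, normSq (H i) ≤ r) i j => ?_
        refine Set.mem_ofPred_eq ▸ le_trans ?_ hH
        exact (Finset.single_le_sum (f := fun j => ‖H i j‖ ^ 2) (fun _ _ => by positivity)
          (Finset.mem_univ j)).trans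
          (Finset.single_le_sum (f := fun i => normSq (H i)) (fun _ _ => normSq_nonneg _)
            (Finset.mem_univ i))
    _ ≤ _ := by
        rw [channelLaw_pi]
        exact pow_le_pow_left₀ zero_le (h r hr) _

/-! ### Two-sided bounds for the error probability -/

theorem exists_measure_errorSet_le {Mr Mt K N : ℕ} (hMt : 0 < Mt)
    {S : Fin K → Matrix (Fin Mt) (Fin Mt) ℂ} (hS : IsMUB S) (hN : Mt ≤ N) (hNK : N ≤ K * Mt)
    {sel : Channel Mr Mt → Fin N} (hsel : IsOptimalSelection (codebook S hNK) sel)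
    (A : Finset ℂ) (N₀ : ℝ≥0) :
    ∃ C : ℝ, 0 < C ∧ ∀ Es : ℝ, 0 < Es → ∀ det : (Fin Mr → ℂ) → (Fin Mr → ℂ) → ℂ,
      IsMinDistDetector A Es det → ∀ s ∈ A,
      ((channelLaw Mr Mt).prod (noiseLaw Mr N₀)) (errorSet (codebook S hNK) sel det Es s) ≤
        ENNReal.ofReal (C * (Es ^ (Mt * Mr))⁻¹) := by
  obtain ⟨δ, hδ, hA⟩ := exists_pos_le_norm_sub A
  obtain ⟨C, hC, hCle⟩ := channelLaw_sum_normSq_le Mr Mt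
  have hMt' : (0 : ℝ) < Mt := Nat.cast_pos.2 hMt
  have hM := lintegral_normSq_pow_lt_top Mr N₀ (Mt * Mr)
  set M := ∫⁻ n, ENNReal.ofReal (normSq n) ^ (Mt * Mr) ∂noiseLaw Mr N₀
  set B : ℝ := C * (Mt * 4 / δ ^ 2)
  have hB : 0 < B := by positivity
  -- The `+ 1` makes the constant positive without a lower bound for the moment `M`.
  refine ⟨B ^ (Mt * Mr) * (M.toReal + 1), by positivity, fun Es hEs det hdet s hs => ?_⟩
  rw [Measure.prod_apply_symm (measurableSet_errorSet hsel hdet s)]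
  calc _ ≤ ∫⁻ n, ENNReal.ofReal (B / Es) ^ (Mt * Mr) * ENNReal.ofReal (normSq n) ^ (Mt * Mr)
        ∂noiseLaw Mr N₀ := by
        refine lintegral_mono fun n => ?_
        have hn := normSq_nonneg n
        rw [← mul_pow, ← ENNReal.ofReal_mul (by positivity)]
        refine (measure_mono fun H hH => ?_).trans
          ((hCle (Mt * 4 / δ ^ 2 / Es * normSq n) (by positivity)).trans_eq ?_)
        · have h1 := hdet.normSq_le_of_ne hEs hδ.le hA hs hH
          refine (hsel.sum_normSq_le hS hN hNK hMt H).trans ?_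
          rw [div_div, div_mul_eq_mul_div, le_div_iff₀ (by positivity)]
          nlinarith
        · congr 2
          simp only [B]; ring
    _ = ENNReal.ofReal (B / Es) ^ (Mt * Mr) * M :=
        lintegral_const_mul' _ _ (by finiteness)
    _ ≤ ENNReal.ofReal (B / Es) ^ (Mt * Mr) * ENNReal.ofReal (M.toReal + 1) := by
        gcongr
        refine (ENNReal.ofReal_toReal hM.ne).symm.trans_le (ENNReal.ofReal_le_ofReal ?_)
        linarith
    _ = _ := by
        rw [← ENNReal.ofReal_pow (by positivity), ← ENNReal.ofReal_mul (by positivity), div_pow]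
        congr 1; ring

/-- Every direction pattern of the noise has a probability that is bounded below. -/
theorem le_noiseLaw_halfPlanes (Mr : ℕ) {N₀ : ℝ≥0} (hN₀ : 0 < N₀) (τ : ℝ) :
    ∃ c : ENNReal, 0 < c ∧ ∀ u : Fin Mr → ℂ,
      c ≤ noiseLaw Mr N₀ {n | ∀ i, ‖u i‖ * τ ≤ (u i * n i).re} := by
  obtain ⟨c, hc, h⟩ := le_complexGaussian_halfPlane hN₀.ne' τ
  refine ⟨c ^ Mr, ENNReal.pow_pos hc Mr, fun u => ?_⟩
  have hset : {n : Fin Mr → ℂ | ∀ i, ‖u i‖ * τ ≤ (u i * n i).re} =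
      Set.pi Set.univ fun i => {z | ‖u i‖ * τ ≤ (u i * z).re} := by
    ext n; simp [Set.mem_pi]
  rw [hset, noiseLaw, Measure.pi_pi]
  calc c ^ Mr = ∏ _i : Fin Mr, c := by simp
    _ ≤ _ := Finset.prod_le_prod' fun i _ => h (u i)

theorem exists_le_measure_errorSet {Mr Mt K N : ℕ} (hMt : 0 < Mt) (hMr : 0 < Mr)
    {S : Fin K → Matrix (Fin Mt) (Fin Mt) ℂ} (hS : IsMUB S) (hN : Mt ≤ N) (hNK : N ≤ K * Mt)
    {sel : Channel Mr Mt → Fin N} (hsel : IsOptimalSelection (codebook S hNK) sel)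
    {A : Finset ℂ} {s t : ℂ} (ht : t ∈ A) (hst : t ≠ s) {N₀ : ℝ≥0} (hN₀ : 0 < N₀) :
    ∃ c : ℝ, 0 < c ∧ ∀ Es : ℝ, 1 ≤ Es → ∀ det : (Fin Mr → ℂ) → (Fin Mr → ℂ) → ℂ,
      IsMinDistDetector A Es det →
      ENNReal.ofReal (c * (Es ^ (Mt * Mr))⁻¹) ≤
        ((channelLaw Mr Mt).prod (noiseLaw Mr N₀)) (errorSet (codebook S hNK) sel det Es s) := by
  obtain ⟨c₁, hc₁, hnoise⟩ := le_noiseLaw_halfPlanes Mr hN₀ (1 * ‖t - s‖)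
  obtain ⟨c₂, hc₂, hbox⟩ := le_complexGaussian_box (v := 1) one_ne_zero
  have hMt' : (1 : ℝ) ≤ Mt := Nat.one_le_cast.2 hMt
  have hMr' : (1 : ℝ) ≤ Mr := Nat.one_le_cast.2 hMr
  have hc₁t : c₁ ≠ ⊤ := ((hnoise 0).trans_lt (measure_lt_top _ _)).ne
  have hc₁' : 0 < c₁.toReal := ENNReal.toReal_pos hc₁.ne' hc₁t
  set B : ℝ := c₂ / (2 * Mt * Mr)
  have hB : 0 < B := by positivity
  refine ⟨c₁.toReal * B ^ (Mt * Mr), by positivity, fun Es hEs det hdet => ?_⟩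
  have hEs0 : 0 < Es := by linarith
  have hD : 1 ≤ 2 * Mt * Mr * Es := by
    have := one_le_mul_of_one_le_of_one_le (one_le_mul_of_one_le_of_one_le hMt' hMr') hEs
    nlinarith
  -- Entries in the box have squared modulus at most `2 * r ^ 2`, so this choice gives `‖H‖² ≤ 1 /
  -- Es`, hence `Es * ‖g‖² ≤ 1`.
  set r : ℝ := √(1 / (2 * Mt * Mr * Es))
  have hr0 : 0 ≤ r := Real.sqrt_nonneg _
  have hr2 : r ^ 2 = 1 / (2 * Mt * Mr * Es) := Real.sq_sqrt (by positivity)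
  have hr1 : r ≤ 1 := Real.sqrt_le_one.2 (div_le_one_of_le₀ hD (by positivity))
  set box : Set (Channel Mr Mt) := {H | ∀ i j, H i j ∈ Set.Ioc 0 r ×ℂ Set.Ioc 0 r}
  have hboxm : MeasurableSet box := by
    have hm : MeasurableSet (Set.Ioc 0 r ×ℂ Set.Ioc 0 r) :=
      (Complex.measurable_re measurableSet_Ioc).inter (Complex.measurable_im measurableSet_Ioc)
    have : box = ⋂ i, ⋂ j, (fun H : Channel Mr Mt => H i j) ⁻¹'
        (Set.Ioc 0 r ×ℂ Set.Ioc 0 r) := by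
      ext H; simp [box]
    rw [this]
    exact .iInter fun i => .iInter fun j => (by fun_prop : Measurable _) hm
  rw [Measure.prod_apply (measurableSet_errorSet hsel hdet s)]
  calc ENNReal.ofReal (c₁.toReal * B ^ (Mt * Mr) * (Es ^ (Mt * Mr))⁻¹)
      = c₁ * ENNReal.ofReal (c₂ * r ^ 2) ^ (Mt * Mr) := by
        nth_rewrite 2 [← ENNReal.ofReal_toReal hc₁t]
        rw [← ENNReal.ofReal_pow (by positivity), ← ENNReal.ofReal_mul hc₁'.le, mul_assoc,
          ← inv_pow, ← mul_pow, hr2]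
        congr 3
        simp only [B]
        field_simp
    _ ≤ c₁ * channelLaw Mr Mt box := by
        rw [channelLaw_pi]
        gcongr
        exact hbox r hr0 hr1
    _ = ∫⁻ _ in box, c₁ ∂channelLaw Mr Mt := (setLIntegral_const _ _).symm
    _ ≤ ∫⁻ H in box, noiseLaw Mr N₀ (Prod.mk H ⁻¹' errorSet (codebook S hNK) sel det Es s)
          ∂channelLaw Mr Mt := by
        refine setLIntegral_mono' hboxm fun H hH => ?_
        set g := effective H (codebook S hNK (sel H))
        refine (hnoise fun i => star (t - s) * star (g i)).trans (measure_mono fun n hn => ?_)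
        have hle : ∑ i, normSq (H i) ≤ 2 * Mt * Mr * r ^ 2 := by
          have h1 : ∀ i j, ‖H i j‖ ^ 2 ≤ 2 * r ^ 2 := fun i j => by
            obtain ⟨⟨ha, hb⟩, hc, hd⟩ := hH i j
            rw [← Complex.normSq_eq_norm_sq, Complex.normSq_apply]
            nlinarith
          calc ∑ i, normSq (H i) ≤ ∑ _i : Fin Mr, ∑ _j : Fin Mt, 2 * r ^ 2 :=
                Finset.sum_le_sum fun i _ => Finset.sum_le_sum fun j _ => h1 i j
            _ = 2 * Mt * Mr * r ^ 2 := by simp; ring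
        have hpos : 0 < ∑ i, normSq (H i) := by
          have : Nonempty (Fin Mr) := ⟨⟨0, hMr⟩⟩
          have : Nonempty (Fin Mt) := ⟨⟨0, hMt⟩⟩
          refine Finset.sum_pos (fun i _ => Finset.sum_pos (fun j _ => ?_)
            Finset.univ_nonempty) Finset.univ_nonempty
          refine pow_pos (norm_pos_iff.2 fun h0 => ?_) 2
          have := (hH i j).1.1
          rw [h0] at this
          exact lt_irrefl _ this
        have hg : 0 < normSq g :=
          pos_of_mul_pos_right (hpos.trans_le (hsel.sum_normSq_le hS hN hNK hMt H))
            (Nat.cast_nonneg _)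
        have hgle : Es * normSq g ≤ 1 ^ 2 := by
          have h1 : normSq g ≤ 1 / Es := by
            refine ((normSq_effective_le H _).trans ?_)
            rw [hS.normSq_codebook, mul_one]
            refine hle.trans_eq ?_
            rw [hr2]
            field_simp
          rw [le_div_iff₀ hEs0] at h1
          linarith
        exact hdet.ne_of_halfPlane ht hst hEs0 hg one_pos hgle hn
    _ ≤ _ := setLIntegral_le_lintegral _ _

/-- Two-sided bounds by multiples of `ρ ^ (-D)` determine the diversity order. -/
theorem hasDiversityOrder_of_le_of_le {Pe : ℝ → ℝ} {D : ℕ} {c C : ℝ} (hc : 0 < c)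
    (hl : ∀ᶠ ρ in atTop, c * (ρ ^ D)⁻¹ ≤ Pe ρ) (hu : ∀ᶠ ρ in atTop, Pe ρ ≤ C * (ρ ^ D)⁻¹) :
    HasDiversityOrder Pe D := by
  have key : ∀ a : ℝ, Tendsto (fun ρ => (D : ℝ) - Real.log a / Real.log ρ) atTop (𝓝 D) :=
    fun a => by simpa using tendsto_const_nhds.sub (Real.tendsto_log_atTop.const_div_atTop _)
  have hlog : ∀ a ρ : ℝ, 0 < a → 1 < ρ →
      -Real.log (a * (ρ ^ D)⁻¹) / Real.log ρ = D - Real.log a / Real.log ρ := fun a ρ ha hρ => by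
    have h0 : 0 < ρ := by linarith
    have := Real.log_pos hρ
    rw [Real.log_mul ha.ne' (by positivity), Real.log_inv, Real.log_pow]
    field_simp
    ring
  refine tendsto_of_tendsto_of_tendsto_of_le_of_le' (key C) (key c) ?_ ?_
  · filter_upwards [hl, hu, eventually_gt_atTop 1] with ρ h1 h2 h3
    have h0 : 0 < ρ := by linarith
    have hpos : 0 < c * (ρ ^ D)⁻¹ := by positivity
    -- The sign of `C` follows from the two bounds together.
    have hC : 0 < C := pos_of_mul_pos_left (hpos.trans_le (h1.trans h2)) (by positivity)
    rw [← hlog C ρ hC h3]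
    have := Real.log_pos h3
    have := Real.log_le_log (hpos.trans_le h1) h2
    gcongr
  · filter_upwards [hl, eventually_gt_atTop 1] with ρ h1 h3
    have h0 : 0 < ρ := by linarith
    have hpos : 0 < c * (ρ ^ D)⁻¹ := by positivity
    rw [← hlog c ρ hc h3]
    have := Real.log_pos h3
    have := Real.log_le_log hpos h1
    gcongr

end LimitedFeedback

theorem theorem2 (Mt Mr K N : ℕ) (hMt : 0 < Mt) (hMr : 0 < Mr)
    (S : Fin K → Matrix (Fin Mt) (Fin Mt) ℂ) (hS : LimitedFeedback.IsMUB S)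
    (hN : Mt ≤ N) (hNK : N ≤ K * Mt)
    (A : Finset ℂ) (hA : 2 ≤ A.card) (N₀ : ℝ≥0) (hN₀ : 0 < N₀)
    (sel : LimitedFeedback.Channel Mr Mt → Fin N)
    (hsel : LimitedFeedback.IsOptimalSelection (LimitedFeedback.codebook S hNK) sel)
    (det : ℝ → (Fin Mr → ℂ) → (Fin Mr → ℂ) → ℂ)
    (hdet : ∀ Es : ℝ, 0 < Es → LimitedFeedback.IsMinDistDetector A Es (det Es)) :
    LimitedFeedback.HasDiversityOrder
      (fun ρ : ℝ => LimitedFeedback.symbolErrorProb (LimitedFeedback.codebook S hNK) A sel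
        (det (ρ * N₀)) (ρ * N₀) N₀)
      ((Mt : ℝ) * (Mr : ℝ)) := by
  obtain ⟨s, hs, t, ht, hst⟩ := Finset.one_lt_card.1 hA
  obtain ⟨c, hc, hl⟩ := LimitedFeedback.exists_le_measure_errorSet hMt hMr hS hN hNK hsel ht
    hst.symm hN₀
  obtain ⟨C, hC, hu⟩ := LimitedFeedback.exists_measure_errorSet_le hMt hS hN hNK hsel A N₀
  have hcard : (0 : ℝ) < A.card := by
    have : 0 < A.card := by omega
    exact_mod_cast this
  have hN₀' : (0 : ℝ) < N₀ := hN₀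
  have h := LimitedFeedback.hasDiversityOrder_of_le_of_le
    (Pe := fun ρ : ℝ => LimitedFeedback.symbolErrorProb (LimitedFeedback.codebook S hNK) A sel
        (det (ρ * N₀)) (ρ * N₀) N₀) (D := Mt * Mr)
    -- The lower bound keeps a single symbol of the average, whence `1 / |A|`; the powers of `N₀`
    -- come from `Es = ρ * N₀`.
    (c := (A.card : ℝ)⁻¹ * (c * ((N₀ : ℝ) ^ (Mt * Mr))⁻¹)) (C := C * ((N₀ : ℝ) ^ (Mt * Mr))⁻¹)
    (by positivity) ?_ ?_
  · rwa [Nat.cast_mul] at h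
  · filter_upwards [eventually_ge_atTop (N₀ : ℝ)⁻¹] with ρ hρ
    have hEs : 1 ≤ ρ * N₀ := (inv_le_iff_one_le_mul₀ hN₀').1 hρ
    have h1 := hl _ hEs _ (hdet _ (by linarith))
    rw [ENNReal.ofReal_le_iff_le_toReal (by finiteness), mul_pow, mul_inv] at h1
    rw [LimitedFeedback.symbolErrorProb, mul_assoc]
    refine mul_le_mul_of_nonneg_left ?_ (by positivity)
    calc c * ((N₀ : ℝ) ^ (Mt * Mr))⁻¹ * (ρ ^ (Mt * Mr))⁻¹
        = c * ((ρ ^ (Mt * Mr))⁻¹ * ((N₀ : ℝ) ^ (Mt * Mr))⁻¹) := by ring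
      _ ≤ _ := h1
      _ ≤ _ := Finset.single_le_sum
          (f := fun s => ((LimitedFeedback.channelLaw Mr Mt).prod
            (LimitedFeedback.noiseLaw Mr N₀)).real
            (LimitedFeedback.errorSet (LimitedFeedback.codebook S hNK) sel (det (ρ * N₀))
              (ρ * N₀) s)) (fun _ _ => measureReal_nonneg) hs
  · filter_upwards [eventually_gt_atTop 0] with ρ hρ
    have hEs : 0 < ρ * N₀ := mul_pos hρ hN₀'
    rw [LimitedFeedback.symbolErrorProb, inv_mul_le_iff₀ hcard, ← nsmul_eq_mul]
    refine Finset.sum_le_card_nsmul _ _ _ fun s hs => ?_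
    have h1 := ENNReal.toReal_le_of_le_ofReal (by positivity) (hu _ hEs _ (hdet _ hEs) s hs)
    refine h1.trans_eq ?_
    rw [mul_pow, mul_inv]
    ring
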